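/- Model. Let $(Y_j)_{j\ge 0}$ be i.i.d. real random variables (transmission delays) with $\Pr(Y_j\in[B_L,B_U])=1$, where $B_L>0$. At time $D_0=0$ the channel is idle and the destination holds an update of age $Y_0$. After the delivery of update $j$ at time $D_j$ the destination waits for a time $Z_j\in[0,M]$, requests update $j+1$ at $R_{j+1}=D_j+Z_j$, and receives it at $D_{j+1}=R_{j+1}+Y_{j+1}$; put $R_0=-Y_0$. The age of information is $\Delta(t)=t-\max\{R_j : D_j\le t\}$. A causal policy $\pi=(Z_0,Z_1,\dots)$ chooses $Z_j$ from the information available at $D_j$ (the delays and waiting periods so far and, possibly, private randomization), of which the later delays are independent; $\Pi$ is the set of causal policies. Let $g:[0,\infty)\to[0,\infty)$ be continuous and nondecreasing. For a query at time $Q>0$ and for query times $Q_1,Q_2,\dots$ put $$\bar h^{one}_{opt}(Q)=\inf_{\pi\in\Pi}E[g(\Delta(Q))],\qquad \bar h_{opt}=\inf_{\pi\in\Pi}\limsup_{n\to\infty}\frac1n E\Big[\sum_{k=1}^n g(\Delta(Q_k))\Big].$$ A measurable function $z(y,a)$ with values in $[0,M]$ and with $z(y,a)\le a$ for $a\ge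 0$ is called an optimal single-query decision function if, whenever the system is started at a delivery point with age $y\in[B_L,B_U]$ and remaining time $a>0$ until the query, no causal policy has a smaller expected age penalty at the query than the stationary deterministic policy $Z_j=z(Y_j,Q-D_j)$. Proposition. Assume that the queries are periodic, $Q_k=kT$ for $k\ge1$, with $T>4B_U$, and that $M\ge B_U$. Then the following hold. 1. $\bar h^{one}_{opt}(Q)$ has the same value $\bar h^{one}_{opt}$ for all $Q>3B_U$, this value is finite, and $\bar h_{opt}=\bar h^{one}_{opt}$. 2. Optimal single-query decision functions exist, and for each of them, $z$, the policy $Z_j=z(Y_j,Q-D_j)$ attains $\bar h^{one}_{opt}(Q)$ for every $Q>0$. 3. For every such $z$, the policy that applies it anew in each query interval, $Z_j=z(Y_j,A_j)$ with $A_j=T(\lfloor D_j/T\rfloor+1)-D_j$ the time from $D_j$ until the next query, is causal and attains $\bar h_{opt}$; moreover, under it $E[g(\Delta(Q_k))]=\bar h_{opt}$ for every $k\ge1$. In particular both infima are minima. -/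

import Mathlib

open MeasureTheory ProbabilityTheory Filter
open scoped ENNReal

noncomputable section

namespace PullOrWait

/-- Delivery times for delays `y` and waiting periods `w` along one realization:
the channel is idle at time `D₀ = 0` (the initial update, of age `y 0`, has just been delivered)
and `D_{j+1} = D_j + Z_j + Y_{j+1}`. -/
def delivery (y w : ℕ → ℝ) : ℕ → ℝ
  | 0 => 0
  | j + 1 => delivery y w j + w j + y (j + 1)

/-- Request (generation) times: `R_j = D_j - Y_j`, so that `R_{j+1} = D_j + Z_j`. -/
def request (y w : ℕ → ℝ) (j : ℕ) : ℝ := delivery y w j - y j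

/-- `U(t) = max {R_j : D_j ≤ t}`, the generation time of the most recently received update. -/
def lastGeneration (y w : ℕ → ℝ) (t : ℝ) : ℝ := sSup {r | ∃ j, delivery y w j ≤ t ∧ r = request y w j}

/-- The age of information `Δ(t) = t - U(t)`. -/
def age (y w : ℕ → ℝ) (t : ℝ) : ℝ := t - lastGeneration y w t

variable {Ω : Type*} [mΩ : MeasurableSpace Ω]

/-- `ℱ j` is a possible information of the destination at the delivery of update `j`: it contains
the delays observed so far (and possibly private randomization), and the future delays are
independent of it. -/
structure IsInformation (P : Measure Ω) (Y : ℕ → Ω → ℝ) (ℱ : Filtration ℕ mΩ) : Prop where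
  measurable_delay : ∀ j, Measurable[ℱ j] (Y j)
  indep_next : ∀ j, Indep (MeasurableSpace.comap (Y (j + 1)) inferInstance) (ℱ j) P

/-- The causal update policies `(Z₀, Z₁, …)` with waiting periods in `[0, M]`. -/
def policies (ℱ : Filtration ℕ mΩ) (M : ℝ) : Set (ℕ → Ω → ℝ) :=
  {Z | ∀ j, Measurable[ℱ j] (Z j) ∧ ∀ ω, Z j ω ∈ Set.Icc 0 M}

/-- `E[g(Δ(t))]` under the policy `Z`, as an expectation of a nonnegative random variable. -/
def expectedPenalty (P : Measure Ω) (g : ℝ → ℝ) (Y Z : ℕ → Ω → ℝ) (t : ℝ) : ℝ≥0∞ :=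
  ∫⁻ ω, ENNReal.ofReal (g (age (fun j => Y j ω) (fun j => Z j ω) t)) ∂P

/-- The optimal single-query value for a query at time `Q`. -/
def singleQueryOpt (P : Measure Ω) (ℱ : Filtration ℕ mΩ) (M : ℝ) (g : ℝ → ℝ) (Y : ℕ → Ω → ℝ)
    (Q : ℝ) : ℝ≥0∞ :=
  ⨅ Z ∈ policies ℱ M, expectedPenalty P g Y Z Q

/-- The query average age penalty `limsup_n E[∑_{k=1}^n g(Δ(Q_k))] / n` of the policy `Z`. -/
def queryAverage (P : Measure Ω) (g : ℝ → ℝ) (Y Z : ℕ → Ω → ℝ) (Q : ℕ → ℝ) : ℝ≥0∞ :=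
  limsup (fun n : ℕ =>
    (∫⁻ ω, ∑ k ∈ Finset.Icc 1 n,
      ENNReal.ofReal (g (age (fun j => Y j ω) (fun j => Z j ω) (Q k))) ∂P) / (n : ℝ≥0∞)) atTop

/-- The optimal query average age penalty of the PoW problem with query times `Q 1, Q 2, …`. -/
def powOpt (P : Measure Ω) (ℱ : Filtration ℕ mΩ) (M : ℝ) (g : ℝ → ℝ) (Y : ℕ → Ω → ℝ)
    (Q : ℕ → ℝ) : ℝ≥0∞ :=
  ⨅ Z ∈ policies ℱ M, queryAverage P g Y Z Q

/-- Delivery times when the waiting period after a delivery at time `d` of an update of delay `y`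
is `f y d`. -/
def feedbackDelivery (f : ℝ → ℝ → ℝ) (y : ℕ → ℝ) : ℕ → ℝ
  | 0 => 0
  | j + 1 => feedbackDelivery f y j + f (y j) (feedbackDelivery f y j) + y (j + 1)

/-- The waiting periods `Z_j = f Y_j D_j` generated by a feedback rule `f`. -/
def feedbackPolicy (f : ℝ → ℝ → ℝ) (Y : ℕ → Ω → ℝ) : ℕ → Ω → ℝ :=
  fun j ω => f (Y j ω) (feedbackDelivery f (fun i => Y i ω) j)

/-- The stationary deterministic policy `Z_j = z(Y_j, Q - D_j)` for a single query at `Q`. -/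
def singleQueryPolicy (z : ℝ → ℝ → ℝ) (Q : ℝ) (Y : ℕ → Ω → ℝ) : ℕ → Ω → ℝ :=
  feedbackPolicy (fun y d => z y (Q - d)) Y

/-- The decision function `z` applied anew in each query interval: `Z_j = z(Y_j, A_j)`, where
`A_j = T (⌊D_j / T⌋ + 1) - D_j` is the time from `D_j` to the next query. -/
def repeatedPolicy (z : ℝ → ℝ → ℝ) (T : ℝ) (Y : ℕ → Ω → ℝ) : ℕ → Ω → ℝ :=
  feedbackPolicy (fun y d => z y (T * ((⌊d / T⌋ : ℝ) + 1) - d)) Y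

/-- The delay process with the initial age fixed to `y`: the system is then at time `0` in the
state "age `y` at a delivery point". -/
def withInitialAge (Y : ℕ → Ω → ℝ) (y : ℝ) : ℕ → Ω → ℝ := Function.update Y 0 (fun _ => y)

/-- `z(y, a)` (age `y`, remaining time `a`) is the decision function of an optimal stationary
deterministic policy of the single query problem: it takes values in `[0, M]`, never postpones a
request beyond the query, and from every state with remaining time `a > 0` and age
`y ∈ [B_L, B_U]` no causal policy has a smaller expected penalty at the query. -/
structure IsOptimalDecision (P : Measure Ω) (ℱ : Filtration ℕ mΩ) (M BL BU : ℝ) (g : ℝ → ℝ)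
    (Y : ℕ → Ω → ℝ) (z : ℝ → ℝ → ℝ) : Prop where
  measurable : Measurable (Function.uncurry z)
  mem_Icc : ∀ y a, z y a ∈ Set.Icc 0 M
  le_remaining : ∀ y a, 0 ≤ a → z y a ≤ a
  optimal : ∀ a, 0 < a → ∀ y ∈ Set.Icc BL BU, ∀ Z ∈ policies ℱ M,
    expectedPenalty P g (withInitialAge Y y) (singleQueryPolicy z a (withInitialAge Y y)) a
      ≤ expectedPenalty P g (withInitialAge Y y) Z a

end PullOrWait

end

open scoped Topology

noncomputable section

namespace PullOrWait

/-! ### Semicontinuity -/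

/-! For one query at `Q`, the state at a delivery is the pair `(x, a)`: `x` is the age at `Q` if
nothing more arrives, `a` the time left. Since every delay is at least `BL`, only finitely many
updates matter, and backward induction gives a lower semicontinuous `value` satisfying the Bellman
equation `value_eq`, with a measurable minimizer (`exists_decision`). Along any causal policy the
expected `value` of the state is nondecreasing (`lintegral_value_mono`), and it is constant when
every request before `Q` is optimal (`lintegral_value_eq`). Once the deliveries have passed `Q` it
equals the expected penalty. Hence the initial `value` is the single-query optimum.

The two problems are linked by the fact that `value` is constant far from the query. A request with
`s` time left is no better than one sent `BU` earlier: the earlier one is answered by then, a wait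
of at most `BU ≤ M` leads back to the same moment, and the state is no worse
(`requestValue_add_le`). It follows that `value` equals `steadyValue` when `a ≥ 3 * BU`
(`value_eq_steadyValue`), and that any request sent with at least `4 * BU` left loses nothing
(`requestValue_eq_steadyValue`).

With `T > 4 * BU`, whatever the repeated policy does before the query at `(k - 1) * T` is therefore
harmless for the query at `k * T`, and afterwards it acts optimally for it. It pays exactly
`steadyValue` at every query, while no causal policy can pay less at any of them. -/

theorem lowerSemicontinuous_lintegral {X α : Type*} [TopologicalSpace X] [FirstCountableTopology X]
    [MeasurableSpace α] {μ : Measure α} {F : X → α → ℝ≥0∞}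
    (hmeas : ∀ p, Measurable (F p)) (hF : ∀ᵐ y ∂μ, LowerSemicontinuous fun p => F p y) :
    LowerSemicontinuous fun p => ∫⁻ y, F p y ∂μ := by
  rw [lowerSemicontinuous_iff_le_liminf]
  intro p
  calc ∫⁻ y, F p y ∂μ ≤ ∫⁻ y, liminf (fun q => F q y) (𝓝 p) ∂μ := by
        refine lintegral_mono_ae ?_
        filter_upwards [hF] with y hy using lowerSemicontinuous_iff_le_liminf.1 hy p
    _ ≤ _ := lintegral_liminf_le hmeas

/-- A strict lower bound near each `(p, z)` becomes uniform over `z ∈ K` by compactness. The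
intermediate `c'` keeps the inequality strict after the infimum. -/
theorem lowerSemicontinuous_biInf_of_isCompact {X Z : Type*} [TopologicalSpace X]
    [TopologicalSpace Z] {K : Set Z} (hK : IsCompact K) {f : X → Z → ℝ≥0∞}
    (hf : LowerSemicontinuous (Function.uncurry f)) :
    LowerSemicontinuous fun p => ⨅ z ∈ K, f p z := by
  intro p c hc
  obtain ⟨c', hcc', hc'⟩ := exists_between hc
  have h : ∀ᶠ q in 𝓝 p, ∀ z ∈ K, c' < f q z := by
    refine hK.eventually_forall_of_forall_eventually fun z hz => ?_
    exact hf (p, z) c' (hc'.trans_le (iInf₂_le z hz))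
  filter_upwards [h] with q hq
  exact hcc'.trans_le (le_iInf₂ fun z hz => (hq z hz).le)

theorem exists_biInf_eq_of_isCompact {Z : Type*} [TopologicalSpace Z] {K : Set Z}
    (hK : IsCompact K) (hne : K.Nonempty) {f : Z → ℝ≥0∞} (hf : LowerSemicontinuous f) :
    ∃ z ∈ K, f z = ⨅ z ∈ K, f z := by
  obtain ⟨z, hz, hmin⟩ := (hf.lowerSemicontinuousOn K).exists_isMinOn hne hK
  exact ⟨z, hz, le_antisymm (le_iInf₂ fun w hw => hmin hw) (iInf₂_le z hz)⟩

/-- The least minimizer on `[0, M]` of a jointly lower semicontinuous function is measurable. -/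
theorem exists_measurable_argmin {X : Type*} [TopologicalSpace X] [MeasurableSpace X]
    [BorelSpace X] {M : ℝ} (hM : 0 ≤ M) {f : X → ℝ → ℝ≥0∞}
    (hf : LowerSemicontinuous (Function.uncurry f)) :
    ∃ ζ : X → ℝ, Measurable ζ ∧
      ∀ p, ζ p ∈ Set.Icc 0 M ∧ f p (ζ p) = ⨅ z ∈ Set.Icc 0 M, f p z := by
  have hsec : ∀ p, LowerSemicontinuous (f p) := fun p =>
    LowerSemicontinuous.comp hf (g := fun z => (p, z)) (by fun_prop)
  set S : X → Set ℝ := fun p => {z | z ∈ Set.Icc 0 M ∧ f p z ≤ ⨅ z ∈ Set.Icc 0 M, f p z} with hS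
  have hne : ∀ p, (S p).Nonempty := fun p => by
    obtain ⟨z, hz, h⟩ := exists_biInf_eq_of_isCompact isCompact_Icc
      (Set.nonempty_Icc.2 hM) (hsec p)
    exact ⟨z, hz, h.le⟩
  have hbdd : ∀ p, BddBelow (S p) := fun p => ⟨0, fun z hz => hz.1.1⟩
  have hclosed : ∀ p, IsClosed (S p) := fun p =>
    isClosed_Icc.inter ((hsec p).isClosed_preimage _)
  have hmem : ∀ p, sInf (S p) ∈ S p := fun p => (hclosed p).csInf_mem (hne p) (hbdd p)
  refine ⟨fun p => sInf (S p), measurable_of_Iic fun c => ?_, fun p => ⟨(hmem p).1,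
    le_antisymm (hmem p).2 (iInf₂_le _ (hmem p).1)⟩⟩
  rcases lt_or_ge c 0 with hc | hc
  · convert MeasurableSet.empty
    ext p
    simpa using hc.trans_le (hmem p).1.1
  -- The least minimizer is at most `c` exactly when minimizing over `[0, min c M]` already reaches
  -- the full minimum. This compares two semicontinuous functions.
  · have key : (fun p => sInf (S p)) ⁻¹' Set.Iic c =
        {p | (⨅ z ∈ Set.Icc 0 (min c M), f p z) ≤ ⨅ z ∈ Set.Icc 0 M, f p z} := by
      ext p
      simp only [Set.mem_preimage, Set.mem_Iic, Set.mem_ofPred_eq]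
      constructor
      · intro h
        exact (iInf₂_le (sInf (S p)) ⟨(hmem p).1.1, le_min h (hmem p).1.2⟩).trans (hmem p).2
      · intro h
        obtain ⟨z, hz, hz'⟩ := exists_biInf_eq_of_isCompact (K := Set.Icc 0 (min c M)) isCompact_Icc
          (Set.nonempty_Icc.2 (le_min hc hM)) (hsec p)
        exact (csInf_le (hbdd p) ⟨⟨hz.1, hz.2.trans (min_le_right _ _)⟩, hz'.le.trans h⟩).trans
          (hz.2.trans (min_le_left _ _))
    rw [key]
    exact measurableSet_le (lowerSemicontinuous_biInf_of_isCompact isCompact_Icc hf).measurable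
      (lowerSemicontinuous_biInf_of_isCompact isCompact_Icc hf).measurable

/-! ### The value function of the single-query problem -/

/-- The cost-to-go after a request sent at remaining time `s` with delay `y`, where `u` is the
cost-to-go at deliveries and `x` the age at the query if nothing is delivered before it. -/
def afterRequest (G : ℝ → ℝ≥0∞) (u : ℝ → ℝ → ℝ≥0∞) (x s y : ℝ) : ℝ≥0∞ :=
  if y ≤ s then u s (s - y) else G (max x s)

/-- The expected cost-to-go of a request sent at remaining time `s`. -/
def requestValue (μ : Measure ℝ) (G : ℝ → ℝ≥0∞) (u : ℝ → ℝ → ℝ≥0∞) (x s : ℝ) : ℝ≥0∞ :=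
  ∫⁻ y, afterRequest G u x s y ∂μ

/-- The optimal cost with at most `n` further updates, at a delivery with remaining time `a`, if
the age at the query is `x` when nothing else is delivered before it. -/
def valueIter (μ : Measure ℝ) (G : ℝ → ℝ≥0∞) (M : ℝ) : ℕ → ℝ → ℝ → ℝ≥0∞
  | 0 => fun x a => G (max x a)
  | n + 1 => fun x a =>
      ⨅ z ∈ Set.Icc 0 M, requestValue μ G (valueIter μ G M n) (max x a) (a - z)

/-- The optimal cost with any number of further updates. As delays are at least `BL`, at most
`a / BL` of them are delivered in time. -/
def value (μ : Measure ℝ) (G : ℝ → ℝ≥0∞) (M BL : ℝ) (x a : ℝ) : ℝ≥0∞ :=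
  valueIter μ G M ⌊a / BL + 1⌋₊ x a

/-- The standing assumptions on the delay distribution `μ` and the penalty `G`. -/
structure IsSetting (μ : Measure ℝ) (G : ℝ → ℝ≥0∞) (M BL BU : ℝ) : Prop where
  prob : IsProbabilityMeasure μ
  pos : 0 < BL
  delay_mem : ∀ᵐ y ∂μ, y ∈ Set.Icc BL BU
  le_wait : BU ≤ M
  continuous : Continuous G
  monotone : Monotone G

namespace IsSetting

variable {μ : Measure ℝ} {G : ℝ → ℝ≥0∞} {M BL BU : ℝ}

theorem BL_le_BU (h : IsSetting μ G M BL BU) : BL ≤ BU := by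
  have := h.prob
  obtain ⟨y, hy⟩ := h.delay_mem.exists
  exact hy.1.trans hy.2

theorem BU_pos (h : IsSetting μ G M BL BU) : 0 < BU := h.pos.trans_le h.BL_le_BU

theorem M_pos (h : IsSetting μ G M BL BU) : 0 < M := h.BU_pos.trans_le h.le_wait

/-- Requesting at once can never hurt. The `max` in the definitions makes this hold on the whole
plane, not only where `a ≤ x`. -/
theorem valueIter_le (h : IsSetting μ G M BL BU) (n : ℕ) (x a : ℝ) :
    valueIter μ G M n x a ≤ G (max x a) := by
  have := h.prob
  induction n generalizing x a with
  | zero => exact le_rfl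
  | succ n ih =>
    refine (iInf₂_le 0 ⟨le_rfl, h.M_pos.le⟩).trans ?_
    calc requestValue μ G (valueIter μ G M n) (max x a) (a - 0)
        ≤ ∫⁻ _, G (max x a) ∂μ := by
          refine lintegral_mono_ae ?_
          filter_upwards [h.delay_mem] with y hy
          have hy0 := h.pos.trans_le hy.1
          unfold afterRequest
          split_ifs with hya
          · refine (ih _ _).trans (h.monotone ?_)
            simp only [sub_zero]
            exact max_le (le_max_right _ _) ((sub_le_self _ hy0.le).trans (le_max_right _ _))
          · simp
      _ = G (max x a) := by simp

theorem measurable_afterRequest (h : IsSetting μ G M BL BU) {u : ℝ → ℝ → ℝ≥0∞}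
    (hu : LowerSemicontinuous (Function.uncurry u)) :
    Measurable fun p : (ℝ × ℝ) × ℝ => afterRequest G u p.1.1 p.1.2 p.2 := by
  have hu' := hu.measurable
  have hG := h.continuous.measurable
  refine Measurable.ite (measurableSet_le measurable_snd (by fun_prop)) ?_ (by fun_prop)
  exact hu'.comp (f := fun p : (ℝ × ℝ) × ℝ => (p.1.2, p.1.2 - p.2)) (by fun_prop)

/-- For fixed `y` the integrand jumps at `s = y`, but downwards: delivery in time includes equality,
and `hle` makes that branch the cheaper one. -/
theorem lowerSemicontinuous_requestValue (h : IsSetting μ G M BL BU) {u : ℝ → ℝ → ℝ≥0∞}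
    (hu : LowerSemicontinuous (Function.uncurry u)) (hle : ∀ x a, u x a ≤ G (max x a)) :
    LowerSemicontinuous (Function.uncurry (requestValue μ G u)) := by
  refine lowerSemicontinuous_lintegral (F := fun p : ℝ × ℝ => afterRequest G u p.1 p.2)
    (fun p => (h.measurable_afterRequest hu).comp (g := fun q : (ℝ × ℝ) × ℝ => _)
      (f := fun y => (p, y)) (by fun_prop)) ?_
  filter_upwards [h.delay_mem] with y hy
  have hy0 := h.pos.trans_le hy.1
  have hle' : ∀ p : ℝ × ℝ, u p.2 (p.2 - y) ≤ G (max p.1 p.2) := fun p => by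
    refine (hle _ _).trans (h.monotone ?_)
    rw [max_eq_left (sub_le_self _ hy0.le)]
    exact le_max_right _ _
  have h1 : LowerSemicontinuous fun p : ℝ × ℝ => u p.2 (p.2 - y) :=
    LowerSemicontinuous.comp hu (g := fun p : ℝ × ℝ => (p.2, p.2 - y)) (by fun_prop)
  have h2 : LowerSemicontinuous fun p : ℝ × ℝ => G (max p.1 p.2) :=
    (h.continuous.comp (by fun_prop)).lowerSemicontinuous
  intro p c hc
  simp only [afterRequest, gt_iff_lt] at hc ⊢
  split_ifs at hc with hyp
  · filter_upwards [h1 p c hc, h2 p c (hc.trans_le (hle' p))] with q hq1 hq2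
    split_ifs
    exacts [hq1, hq2]
  · have : ∀ᶠ q : ℝ × ℝ in 𝓝 p, q.2 < y :=
      (continuous_snd.tendsto p).eventually_lt_const (not_le.1 hyp)
    filter_upwards [h2 p c hc, this] with q hq2 hq
    rwa [if_neg hq.not_ge]

theorem lowerSemicontinuous_requestValue_shift (h : IsSetting μ G M BL BU) {u : ℝ → ℝ → ℝ≥0∞}
    (hu : LowerSemicontinuous (Function.uncurry u)) (hle : ∀ x a, u x a ≤ G (max x a)) :
    LowerSemicontinuous (Function.uncurry fun (p : ℝ × ℝ) (z : ℝ) =>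
      requestValue μ G u (max p.1 p.2) (p.2 - z)) :=
  LowerSemicontinuous.comp (h.lowerSemicontinuous_requestValue hu hle)
    (g := fun q : (ℝ × ℝ) × ℝ => (max q.1.1 q.1.2, q.1.2 - q.2)) (by fun_prop)

theorem lowerSemicontinuous_valueIter (h : IsSetting μ G M BL BU) (n : ℕ) :
    LowerSemicontinuous (Function.uncurry (valueIter μ G M n)) := by
  induction n with
  | zero => exact (h.continuous.comp (continuous_fst.max continuous_snd)).lowerSemicontinuous
  | succ n ih =>
    exact lowerSemicontinuous_biInf_of_isCompact isCompact_Icc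
      (h.lowerSemicontinuous_requestValue_shift ih (h.valueIter_le n))

/-- In time less than `n * BL` fewer than `n` further updates can arrive, so allowing one more
changes nothing. -/
theorem valueIter_succ_eq (h : IsSetting μ G M BL BU) (n : ℕ) (x a : ℝ) (ha : a < n * BL) :
    valueIter μ G M (n + 1) x a = valueIter μ G M n x a := by
  have := h.prob
  induction n generalizing x a with
  | zero =>
    have ha' : a < 0 := by simpa using ha
    have key : ∀ z ∈ Set.Icc 0 M,
        requestValue μ G (valueIter μ G M 0) (max x a) (a - z) = G (max x a) := fun z hz => by
      have : ∀ᵐ y ∂μ, afterRequest G (valueIter μ G M 0) (max x a) (a - z) y = G (max x a) := by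
        filter_upwards [h.delay_mem] with y hy
        have := h.pos.trans_le hy.1
        have := hz.1
        rw [afterRequest, if_neg (by linarith), max_eq_left (by linarith [le_max_right x a])]
      rw [requestValue, lintegral_congr_ae this]
      simp
    change (⨅ z ∈ Set.Icc 0 M, _) = G (max x a)
    rw [biInf_congr key, biInf_const (Set.nonempty_Icc.2 h.M_pos.le)]
  | succ n ih =>
    change (⨅ z ∈ Set.Icc 0 M, _) = (⨅ z ∈ Set.Icc 0 M, _)
    refine biInf_congr fun z hz => lintegral_congr_ae ?_
    filter_upwards [h.delay_mem] with y hy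
    unfold afterRequest
    have := hz.1
    have := hy.1
    rw [ih _ _ (by push_cast at ha; linarith)]

theorem value_eq_valueIter (h : IsSetting μ G M BL BU) {n : ℕ} {x a : ℝ} (ha : a < n * BL) :
    value μ G M BL x a = valueIter μ G M n x a := by
  have hpos := h.pos
  have h1 : a < (⌊a / BL + 1⌋₊ : ℝ) * BL := by
    rcases lt_or_ge a 0 with h0 | h0
    · exact h0.trans_le (by positivity)
    · rw [← div_lt_iff₀ hpos]
      linarith [Nat.lt_floor_add_one (a / BL + 1)]
  -- The index chosen in `value` is the least natural number `n` with `a < n * BL`; from there on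
  -- the iterates are constant.
  have h2 : ⌊a / BL + 1⌋₊ ≤ n := by
    rcases lt_or_ge a 0 with h0 | h0
    · rw [Nat.floor_eq_zero.2 (by linarith [div_neg_of_neg_of_pos h0 hpos])]
      exact Nat.zero_le n
    · have : a / BL < n := (div_lt_iff₀ hpos).2 ha
      rw [Nat.floor_add_one (by positivity), Nat.succ_le_iff, Nat.floor_lt (by positivity)]
      exact this
  unfold value
  induction n, h2 using Nat.le_induction with
  | base => rfl
  | succ m hm ih =>
    have hm' : a < m * BL := h1.trans_le (by gcongr)
    rw [h.valueIter_succ_eq m x a hm', ih hm']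

theorem lowerSemicontinuous_value (h : IsSetting μ G M BL BU) :
    LowerSemicontinuous (Function.uncurry (value μ G M BL)) := by
  intro p c hc
  obtain ⟨n, hn⟩ := exists_nat_gt (p.2 / BL)
  have hp : p.2 < n * BL := (div_lt_iff₀ h.pos).1 hn
  have hev : ∀ᶠ q : ℝ × ℝ in 𝓝 p, q.2 < n * BL :=
    (continuous_snd.tendsto p).eventually_lt_const hp
  have hc' : c < Function.uncurry (valueIter μ G M n) p := by
    rwa [Function.uncurry, ← h.value_eq_valueIter hp]
  filter_upwards [hev, h.lowerSemicontinuous_valueIter n p c hc'] with q hq hcq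
  rw [Function.uncurry, h.value_eq_valueIter hq]
  exact hcq

theorem value_le (h : IsSetting μ G M BL BU) (x a : ℝ) : value μ G M BL x a ≤ G (max x a) :=
  h.valueIter_le _ x a

theorem value_of_neg (h : IsSetting μ G M BL BU) {x a : ℝ} (ha : a < 0) :
    value μ G M BL x a = G (max x a) :=
  h.value_eq_valueIter (n := 0) (by simpa using ha)

/-- The Bellman equation. -/
theorem value_eq (h : IsSetting μ G M BL BU) (x a : ℝ) :
    value μ G M BL x a =
      ⨅ z ∈ Set.Icc 0 M, requestValue μ G (value μ G M BL) (max x a) (a - z) := by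
  obtain ⟨n, hn⟩ := exists_nat_gt (a / BL)
  have ha : a < n * BL := (div_lt_iff₀ h.pos).1 hn
  rw [h.value_eq_valueIter ha, ← h.valueIter_succ_eq n x a ha]
  change (⨅ z ∈ Set.Icc 0 M, _) = _
  refine biInf_congr fun z hz => lintegral_congr_ae ?_
  filter_upwards [h.delay_mem] with y hy
  unfold afterRequest
  have := hz.1
  have := h.pos.trans_le hy.1
  rw [h.value_eq_valueIter (n := n) (by linarith)]

theorem value_le_requestValue (h : IsSetting μ G M BL BU) {x a s : ℝ} (hax : a ≤ x)
    (hs : a - M ≤ s) (hsa : s ≤ a) :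
    value μ G M BL x a ≤ requestValue μ G (value μ G M BL) x s := by
  rw [h.value_eq, max_eq_left hax]
  refine (iInf₂_le (a - s) ⟨by linarith, by linarith⟩).trans ?_
  rw [sub_sub_cancel]

theorem requestValue_of_nonpos (h : IsSetting μ G M BL BU) (u : ℝ → ℝ → ℝ≥0∞) {x s : ℝ}
    (hs : s ≤ 0) : requestValue μ G u x s = G (max x s) := by
  have := h.prob
  have : ∀ᵐ y ∂μ, afterRequest G u x s y = G (max x s) := by
    filter_upwards [h.delay_mem] with y hy
    have := h.pos.trans_le hy.1
    rw [afterRequest, if_neg (by linarith)]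
  rw [requestValue, lintegral_congr_ae this]
  simp

theorem value_of_nonpos (h : IsSetting μ G M BL BU) {x a : ℝ} (ha : a ≤ 0) (hax : a ≤ x) :
    value μ G M BL x a = G x := by
  rw [h.value_eq, max_eq_left hax]
  have key : ∀ z ∈ Set.Icc 0 M, requestValue μ G (value μ G M BL) x (a - z) = G x :=
    fun z hz => by
      rw [h.requestValue_of_nonpos _ (by linarith [hz.1]), max_eq_left (by linarith [hz.1])]
  rw [biInf_congr key, biInf_const (Set.nonempty_Icc.2 h.M_pos.le)]

theorem exists_decision (h : IsSetting μ G M BL BU) :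
    ∃ z : ℝ → ℝ → ℝ, Measurable (Function.uncurry z) ∧ (∀ y a, z y a ∈ Set.Icc 0 M) ∧
      (∀ y a, 0 ≤ a → z y a ≤ a) ∧
      ∀ y a, 0 ≤ y → 0 ≤ a → requestValue μ G (value μ G M BL) (y + a) (a - z y a) =
        value μ G M BL (y + a) a := by
  obtain ⟨ζ, hζm, hζ⟩ := exists_measurable_argmin h.M_pos.le
    (h.lowerSemicontinuous_requestValue_shift h.lowerSemicontinuous_value h.value_le)
  refine ⟨fun y a => max 0 (min a (ζ (y + a, a))), ?_, fun y a => ⟨le_max_left _ _, max_le h.M_pos.le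
    ((min_le_right _ _).trans (hζ _).1.2)⟩, fun y a ha => max_le ha (min_le_left _ _), ?_⟩
  · exact measurable_const.max (measurable_snd.min
      (hζm.comp (f := fun p : ℝ × ℝ => (p.1 + p.2, p.2)) (by fun_prop)))
  · intro y a hy ha
    have hmin := (hζ (y + a, a)).2
    dsimp only at hmin
    rw [← h.value_eq, max_eq_left (by linarith)] at hmin
    have hζ0 := (hζ (y + a, a)).1.1
    dsimp only
    rw [max_eq_right (le_min ha hζ0), ← hmin]
    rcases le_total a (ζ (y + a, a)) with hle | hle
    · rw [min_eq_left hle, h.requestValue_of_nonpos _ (by linarith),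
        h.requestValue_of_nonpos _ (by linarith), max_eq_left (by linarith),
        max_eq_left (by linarith)]
    · rw [min_eq_right hle]

end IsSetting

/-! ### The value far from the query -/

/-- The optimal expected cost of the requests that are certainly answered before the query. -/
def steadyValue (μ : Measure ℝ) (G : ℝ → ℝ≥0∞) (M BL BU : ℝ) : ℝ≥0∞ :=
  ⨅ s ∈ Set.Icc BU (3 * BU), requestValue μ G (value μ G M BL) s s

namespace IsSetting

variable {μ : Measure ℝ} {G : ℝ → ℝ≥0∞} {M BL BU : ℝ}

theorem requestValue_mono_left (h : IsSetting μ G M BL BU) (u : ℝ → ℝ → ℝ≥0∞) {x x' : ℝ}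
    (hx : x ≤ x') (s : ℝ) : requestValue μ G u x s ≤ requestValue μ G u x' s := by
  refine lintegral_mono fun y => ?_
  unfold afterRequest
  split_ifs
  exacts [le_rfl, h.monotone (max_le_max_right s hx)]

theorem requestValue_eq_of_le (h : IsSetting μ G M BL BU) (u : ℝ → ℝ → ℝ≥0∞) (x x' : ℝ) {s : ℝ}
    (hs : BU ≤ s) : requestValue μ G u x s = requestValue μ G u x' s := by
  refine lintegral_congr_ae ?_
  filter_upwards [h.delay_mem] with y hy
  simp only [afterRequest, if_pos (hy.2.trans hs)]

/-- Requesting earlier by `BU` and then waiting for the same moment is at least as good. -/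
theorem requestValue_add_le (h : IsSetting μ G M BL BU) (x : ℝ) {x' s : ℝ} (hs : 0 ≤ s)
    (hx' : s + BU ≤ x') : requestValue μ G (value μ G M BL) x (s + BU) ≤
      requestValue μ G (value μ G M BL) x' s := by
  have := h.prob
  calc requestValue μ G (value μ G M BL) x (s + BU)
      ≤ ∫⁻ _, requestValue μ G (value μ G M BL) x' s ∂μ := by
        refine lintegral_mono_ae ?_
        filter_upwards [h.delay_mem] with y hy
        have := hy.2
        have := h.pos.trans_le hy.1
        have := h.le_wait
        rw [afterRequest, if_pos (by linarith)]
        exact (h.value_le_requestValue (s := s) (by linarith) (by linarith) (by linarith)).trans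
          (h.requestValue_mono_left _ hx' s)
    _ = _ := by simp

/-- Shifting by `BU` repeatedly brings the request within `BU ≤ M` of `a`, where one waiting period
reaches it. -/
theorem exists_requestValue_le (h : IsSetting μ G M BL BU) {a s : ℝ} (hs : BU ≤ s) (hsa : s ≤ a) :
    ∃ s' ∈ Set.Icc (a - BU) a, BU ≤ s' ∧ requestValue μ G (value μ G M BL) s' s' ≤
      requestValue μ G (value μ G M BL) s s := by
  have hBU := h.BU_pos
  obtain ⟨n, hn⟩ := exists_nat_ge ((a - s) / BU)
  rw [div_le_iff₀ hBU] at hn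
  induction n generalizing s with
  | zero => exact ⟨s, ⟨by linarith [show a - s ≤ 0 by simpa using hn], hsa⟩, hs, le_rfl⟩
  | succ n ih =>
    rcases le_or_gt (a - BU) s with h1 | h1
    · exact ⟨s, ⟨h1, hsa⟩, hs, le_rfl⟩
    · push_cast at hn
      obtain ⟨s', hs', hs'', hle⟩ := ih (s := s + BU) (by linarith) (by linarith) (by linarith)
      refine ⟨s', hs', hs'', hle.trans ?_⟩
      rw [h.requestValue_eq_of_le _ s (s + BU) hs]
      exact h.requestValue_add_le _ (by linarith) le_rfl

theorem value_le_requestValue_of_le (h : IsSetting μ G M BL BU) {x a s : ℝ} (hax : a ≤ x)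
    (hs : BU ≤ s) (hsa : s ≤ a) :
    value μ G M BL x a ≤ requestValue μ G (value μ G M BL) s s := by
  obtain ⟨s', hs', hs'', hle⟩ := h.exists_requestValue_le hs hsa
  refine le_trans ?_ hle
  rw [h.requestValue_eq_of_le _ s' x hs'']
  exact h.value_le_requestValue hax (by linarith [hs'.1, h.le_wait]) hs'.2

/-- Requests with less than `BU` left are dominated by their shifts by `BU`, which stay below `a`
because `2 * BU ≤ a`. A request after the query costs the same as one at it. -/
theorem le_value_of_forall (h : IsSetting μ G M BL BU) {x a : ℝ} {c : ℝ≥0∞} (ha : 2 * BU ≤ a)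
    (hax : a ≤ x)
    (hc : ∀ s ∈ Set.Icc BU a, c ≤ requestValue μ G (value μ G M BL) s s) :
    c ≤ value μ G M BL x a := by
  have hBU := h.BU_pos
  rw [h.value_eq, max_eq_left hax]
  refine le_iInf₂ fun z hz => ?_
  set s := a - z with hs
  have hsa : s ≤ a := by linarith [hz.1]
  rcases le_or_gt BU s with h1 | h1
  · rw [h.requestValue_eq_of_le _ x s h1]
    exact hc s ⟨h1, hsa⟩
  rcases le_or_gt 0 s with h2 | h2
  · exact (hc (s + BU) ⟨by linarith, by linarith⟩).trans
      (h.requestValue_add_le _ h2 (by linarith))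
  · have h3 := h.requestValue_add_le (0 + BU) (x' := x) (s := 0) le_rfl (by linarith)
    rw [h.requestValue_of_nonpos _ le_rfl, max_eq_left (by linarith)] at h3
    rw [h.requestValue_of_nonpos _ h2.le, max_eq_left (by linarith)]
    exact (hc (0 + BU) ⟨by linarith, by linarith⟩).trans h3

theorem steadyValue_le (h : IsSetting μ G M BL BU) {s : ℝ} (hs : BU ≤ s) :
    steadyValue μ G M BL BU ≤ requestValue μ G (value μ G M BL) s s := by
  have := h.prob
  have hBL := h.pos
  obtain ⟨n, hn⟩ := exists_nat_ge ((s - 3 * BU) / BL)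
  rw [div_le_iff₀ hBL] at hn
  induction n generalizing s with
  | zero => exact iInf₂_le s ⟨hs, by linarith [show s - 3 * BU ≤ 0 by simpa using hn]⟩
  | succ n ih =>
    rcases le_or_gt s (3 * BU) with h1 | h1
    · exact iInf₂_le s ⟨hs, h1⟩
    · push_cast at hn
      calc steadyValue μ G M BL BU = ∫⁻ _, steadyValue μ G M BL BU ∂μ := by simp
        _ ≤ _ := by
          refine lintegral_mono_ae ?_
          filter_upwards [h.delay_mem] with y hy
          have := hy.2
          have := hy.1
          rw [afterRequest, if_pos (by linarith)]
          -- As `s > 3 * BU`, at least `2 * BU` is left at the delivery. The next request has `s' ≤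
          -- s - y ≤ s - BL`, so the induction counter drops.
          refine h.le_value_of_forall (by linarith) (by linarith) fun s' hs' => ?_
          have := hs'.2
          exact ih hs'.1 (by linarith)

theorem value_eq_steadyValue (h : IsSetting μ G M BL BU) {x a : ℝ} (ha : 3 * BU ≤ a)
    (hax : a ≤ x) : value μ G M BL x a = steadyValue μ G M BL BU :=
  le_antisymm
    (le_iInf₂ fun _ hs => h.value_le_requestValue_of_le hax hs.1 (hs.2.trans ha))
    (h.le_value_of_forall (by linarith [h.BU_pos]) hax fun _ hs => h.steadyValue_le hs.1)

theorem requestValue_eq_steadyValue (h : IsSetting μ G M BL BU) (x : ℝ) {s : ℝ}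
    (hs : 4 * BU ≤ s) :
    requestValue μ G (value μ G M BL) x s = steadyValue μ G M BL BU := by
  have := h.prob
  have hBU := h.BU_pos
  have : ∀ᵐ y ∂μ, afterRequest G (value μ G M BL) x s y = steadyValue μ G M BL BU := by
    filter_upwards [h.delay_mem] with y hy
    have := hy.2
    have := h.pos.trans_le hy.1
    rw [afterRequest, if_pos (by linarith),
      h.value_eq_steadyValue (by linarith) (by linarith)]
  rw [requestValue, lintegral_congr_ae this]
  simp

end IsSetting

/-! ### The age at the query -/

/-- The generation time of the freshest of the updates `0, …, j` that are delivered by time `Q`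
(update `0` always counts). -/
def freshest (y w : ℕ → ℝ) (Q : ℝ) : ℕ → ℝ
  | 0 => request y w 0
  | j + 1 => if delivery y w (j + 1) ≤ Q then request y w (j + 1) else freshest y w Q j

section Path

variable {y w : ℕ → ℝ} {Q BL : ℝ}

theorem mul_le_delivery (hy : ∀ j, BL ≤ y j) (hw : ∀ j, 0 ≤ w j) (j : ℕ) :
    j * BL ≤ delivery y w j := by
  induction j with
  | zero => simp [delivery]
  | succ j ih =>
    push_cast
    simp only [delivery]
    linarith [hy (j + 1), hw j]

theorem request_succ (j : ℕ) : request y w (j + 1) = delivery y w j + w j := by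
  simp [request, delivery]

theorem request_le_delivery (hy : ∀ j, 0 ≤ y j) (j : ℕ) : request y w j ≤ delivery y w j :=
  sub_le_self _ (hy j)

theorem request_mono (hy : ∀ j, 0 ≤ y j) (hw : ∀ j, 0 ≤ w j) : Monotone (request y w) :=
  monotone_nat_of_le_succ fun j => by
    rw [request_succ]
    linarith [request_le_delivery (w := w) hy j, hw j]

theorem delivery_mono (hy : ∀ j, 0 ≤ y j) (hw : ∀ j, 0 ≤ w j) : Monotone (delivery y w) :=
  monotone_nat_of_le_succ fun j => by
    simp only [delivery]
    linarith [hy (j + 1), hw j]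

theorem isGreatest_freshest (hy : ∀ j, 0 ≤ y j) (hw : ∀ j, 0 ≤ w j) (hQ : 0 ≤ Q) (n : ℕ) :
    IsGreatest {r | ∃ j ≤ n, delivery y w j ≤ Q ∧ r = request y w j} (freshest y w Q n) := by
  induction n with
  | zero =>
    refine ⟨⟨0, le_rfl, hQ, rfl⟩, ?_⟩
    rintro r ⟨j, hj, -, rfl⟩
    rw [Nat.le_zero.1 hj]
    exact le_rfl
  | succ n ih =>
    unfold freshest
    split_ifs with h
    · refine ⟨⟨n + 1, le_rfl, h, rfl⟩, ?_⟩
      rintro r ⟨j, hj, -, rfl⟩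
      exact request_mono hy hw hj
    · obtain ⟨⟨j, hj, hj'⟩, hub⟩ := ih
      refine ⟨⟨j, hj.trans n.le_succ, hj'⟩, ?_⟩
      rintro r ⟨i, hi, hiQ, rfl⟩
      rcases Nat.le_succ_iff.1 hi with hi | rfl
      · exact hub ⟨i, hi, hiQ, rfl⟩
      · exact absurd hiQ h

/-- Deliveries are monotone, so after one beyond `Q` no later update counts and the supremum is a
finite maximum. -/
theorem lastGeneration_eq_freshest (hy : ∀ j, 0 ≤ y j) (hw : ∀ j, 0 ≤ w j) (hQ : 0 ≤ Q) {n : ℕ}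
    (hn : Q < delivery y w n) : lastGeneration y w Q = freshest y w Q n := by
  have h := isGreatest_freshest hy hw hQ n
  rw [lastGeneration, ← h.csSup_eq]
  congr 1
  ext r
  refine ⟨?_, fun ⟨j, _, hj⟩ => ⟨j, hj⟩⟩
  rintro ⟨j, hj, rfl⟩
  exact ⟨j, le_of_not_gt fun hnj => (hn.trans_le (delivery_mono hy hw hnj.le)).not_ge hj, hj, rfl⟩

theorem freshest_le_delivery (hy : ∀ j, 0 ≤ y j) (hw : ∀ j, 0 ≤ w j) (hQ : 0 ≤ Q) (n : ℕ) :
    freshest y w Q n ≤ delivery y w n := by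
  obtain ⟨⟨j, hj, _, h⟩, -⟩ := isGreatest_freshest hy hw hQ n
  rw [h]
  exact (request_le_delivery hy j).trans (delivery_mono hy hw hj)

theorem freshest_le (hy : ∀ j, 0 ≤ y j) (hw : ∀ j, 0 ≤ w j) (hQ : 0 ≤ Q) (n : ℕ) :
    freshest y w Q n ≤ Q := by
  obtain ⟨⟨j, _, hj, h⟩, -⟩ := isGreatest_freshest hy hw hQ n
  rw [h]
  exact (request_le_delivery hy j).trans hj

theorem freshest_eq_of_delivery_le {j : ℕ} (hj : delivery y w j ≤ Q) :
    freshest y w Q j = request y w j := by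
  cases j with
  | zero => rfl
  | succ j => exact if_pos hj

end Path

/-! ### The state of the system at a delivery -/

section State

variable {Ω : Type*}

/-- The age at the query if nothing is delivered after update `j`. -/
def ageBound (Y Z : ℕ → Ω → ℝ) (Q : ℝ) (j : ℕ) (ω : Ω) : ℝ :=
  Q - freshest (fun i => Y i ω) (fun i => Z i ω) Q j

/-- The time left until the query at the delivery of update `j`. -/
def remaining (Y Z : ℕ → Ω → ℝ) (Q : ℝ) (j : ℕ) (ω : Ω) : ℝ :=
  Q - delivery (fun i => Y i ω) (fun i => Z i ω) j

variable {Y Z : ℕ → Ω → ℝ} {Q : ℝ}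

theorem ageBound_zero (ω : Ω) : ageBound Y Z Q 0 ω = Y 0 ω + Q := by
  simp [ageBound, freshest, request, delivery, add_comm]

theorem remaining_zero (ω : Ω) : remaining Y Z Q 0 ω = Q := by
  simp [remaining, delivery]

theorem ageBound_of_remaining_nonneg {j : ℕ} {ω : Ω} (hj : 0 ≤ remaining Y Z Q j ω) :
    ageBound Y Z Q j ω = Y j ω + remaining Y Z Q j ω := by
  rw [ageBound, freshest_eq_of_delivery_le (sub_nonneg.1 hj), request, remaining]
  ring

end State

/-! ### The expected cost along a causal policy -/

variable {Ω : Type*} [mΩ : MeasurableSpace Ω]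

/-- Delays `Y` with values in `[BL, BU]`, those of the later updates having law `μ`. -/
structure IsDelayProcess (P : Measure Ω) (Y : ℕ → Ω → ℝ) (ℱ : Filtration ℕ mΩ) (μ : Measure ℝ)
    (BL BU : ℝ) : Prop where
  info : IsInformation P Y ℱ
  law : ∀ j, P.map (Y (j + 1)) = μ
  mem : ∀ j, ∀ᵐ ω ∂P, Y j ω ∈ Set.Icc BL BU

theorem IsDelayProcess.ae_bounds {P : Measure Ω} {Y : ℕ → Ω → ℝ} {ℱ : Filtration ℕ mΩ}
    {μ : Measure ℝ} {BL BU : ℝ} (hY : IsDelayProcess P Y ℱ μ BL BU) :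
    ∀ᵐ ω ∂P, ∀ j, Y j ω ∈ Set.Icc BL BU := ae_all_iff.2 hY.mem

theorem measurable_delivery {ℱ : Filtration ℕ mΩ} {Y Z : ℕ → Ω → ℝ}
    (hY : ∀ j, Measurable[ℱ j] (Y j)) (hZ : ∀ j, Measurable[ℱ j] (Z j)) (j : ℕ) :
    Measurable[ℱ j] fun ω => delivery (fun i => Y i ω) (fun i => Z i ω) j := by
  induction j with
  | zero => exact measurable_const
  | succ j ih =>
    exact ((ih.mono (ℱ.mono j.le_succ) le_rfl).add ((hZ j).mono (ℱ.mono j.le_succ) le_rfl)).add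
      (hY (j + 1))

theorem measurable_freshest {ℱ : Filtration ℕ mΩ} {Y Z : ℕ → Ω → ℝ}
    (hY : ∀ j, Measurable[ℱ j] (Y j)) (hZ : ∀ j, Measurable[ℱ j] (Z j)) (Q : ℝ) (j : ℕ) :
    Measurable[ℱ j] fun ω => freshest (fun i => Y i ω) (fun i => Z i ω) Q j := by
  induction j with
  | zero => exact (measurable_delivery hY hZ 0).sub (hY 0)
  | succ j ih =>
    have hD := measurable_delivery hY hZ (j + 1)
    exact Measurable.ite (@measurableSet_le _ _ _ _ _ (ℱ (j + 1)) _ _ _ _ _ hD measurable_const)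
      (hD.sub (hY (j + 1))) (ih.mono (ℱ.mono j.le_succ) le_rfl)

theorem lintegral_comp_of_indepFun {P : Measure Ω} [IsProbabilityMeasure P] {E : Type*}
    [MeasurableSpace E] {ξ : Ω → E} {η : Ω → ℝ} {μ : Measure ℝ} (hξ : Measurable ξ)
    (hη : Measurable η) (hμ : P.map η = μ) (hind : IndepFun ξ η P) {F : E × ℝ → ℝ≥0∞}
    (hF : Measurable F) :
    ∫⁻ ω, F (ξ ω, η ω) ∂P = ∫⁻ ω, ∫⁻ y, F (ξ ω, y) ∂μ ∂P := by
  subst hμ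
  have := Measure.isProbabilityMeasure_map (μ := P) hη.aemeasurable
  have := Measure.isProbabilityMeasure_map (μ := P) hξ.aemeasurable
  rw [← lintegral_map (f := F) hF (hξ.prodMk hη),
    hind.map_prod_eq_prod_map_map hξ.aemeasurable hη.aemeasurable,
    lintegral_prod _ hF.aemeasurable, lintegral_map hF.lintegral_prod_right' hξ]

section Cost

variable {P : Measure Ω} [IsProbabilityMeasure P] {Y Z : ℕ → Ω → ℝ} {ℱ : Filtration ℕ mΩ}
  {μ : Measure ℝ} {G : ℝ → ℝ≥0∞} {M BL BU Q : ℝ}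

omit [IsProbabilityMeasure P] in
theorem ae_remaining_le_ageBound (h : IsSetting μ G M BL BU) (hY : IsDelayProcess P Y ℱ μ BL BU)
    (hZ : Z ∈ policies ℱ M) (hQ : 0 ≤ Q) :
    ∀ᵐ ω ∂P, ∀ j, remaining Y Z Q j ω ≤ ageBound Y Z Q j ω := by
  filter_upwards [hY.ae_bounds] with ω hω j
  exact sub_le_sub_left (freshest_le_delivery (fun i => h.pos.le.trans (hω i).1)
    (fun i => ((hZ i).2 ω).1) hQ j) Q

/-- The state and the wait at step `j` are known to `ℱ j`, while the next delay is independent of it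
and can be integrated out. -/
theorem lintegral_value_succ (h : IsSetting μ G M BL BU) (hY : IsDelayProcess P Y ℱ μ BL BU)
    (hZ : Z ∈ policies ℱ M) (hQ : 0 ≤ Q) (j : ℕ) :
    ∫⁻ ω, value μ G M BL (ageBound Y Z Q (j + 1) ω) (remaining Y Z Q (j + 1) ω) ∂P =
      ∫⁻ ω, requestValue μ G (value μ G M BL) (ageBound Y Z Q j ω)
        (remaining Y Z Q j ω - Z j ω) ∂P := by
  set ξ : Ω → ℝ × ℝ := fun ω => (ageBound Y Z Q j ω, remaining Y Z Q j ω - Z j ω) with hξ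
  -- Both branches keep `value`, so that the next state is matched pointwise; the late branch turns
  -- into the penalty only almost everywhere.
  set F : (ℝ × ℝ) × ℝ → ℝ≥0∞ := fun p =>
    if p.2 ≤ p.1.2 then value μ G M BL p.1.2 (p.1.2 - p.2)
    else value μ G M BL p.1.1 (p.1.2 - p.2) with hF
  have hv := h.lowerSemicontinuous_value.measurable
  have hFm : Measurable F := by
    refine Measurable.ite (measurableSet_le measurable_snd (by fun_prop)) ?_ ?_
    · exact hv.comp (f := fun p : (ℝ × ℝ) × ℝ => (p.1.2, p.1.2 - p.2)) (by fun_prop)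
    · exact hv.comp (f := fun p : (ℝ × ℝ) × ℝ => (p.1.1, p.1.2 - p.2)) (by fun_prop)
  have hYm := hY.info.measurable_delay
  have hZm := fun i => (hZ i).1
  have hξm : Measurable[ℱ j] ξ :=
    (measurable_const.sub (measurable_freshest hYm hZm Q j)).prodMk
      ((measurable_const.sub (measurable_delivery hYm hZm j)).sub (hZm j))
  have hind : IndepFun ξ (Y (j + 1)) P := by
    rw [IndepFun_iff_Indep]
    exact indep_of_indep_of_le_left (hY.info.indep_next j).symm hξm.comap_le
  have hstep : ∀ ω, value μ G M BL (ageBound Y Z Q (j + 1) ω) (remaining Y Z Q (j + 1) ω) =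
      F (ξ ω, Y (j + 1) ω) := by
    intro ω
    have e1 : remaining Y Z Q (j + 1) ω =
        remaining Y Z Q j ω - Z j ω - Y (j + 1) ω := by
      simp only [remaining, delivery]
      ring
    simp only [hF, hξ, e1]
    split_ifs with hle
    · have hD : delivery (fun i => Y i ω) (fun i => Z i ω) (j + 1) ≤ Q := by
        simp only [remaining] at e1 hle
        linarith
      congr 1
      simp only [ageBound, freshest, if_pos hD, request_succ, remaining]
      ring
    · have hD : ¬ delivery (fun i => Y i ω) (fun i => Z i ω) (j + 1) ≤ Q := fun hc => by
        simp only [remaining] at e1 hle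
        linarith
      simp only [ageBound, freshest, if_neg hD]
  rw [lintegral_congr hstep, lintegral_comp_of_indepFun (hξm.mono (ℱ.le j) le_rfl)
    ((hYm (j + 1)).mono (ℱ.le _) le_rfl) (hY.law j) hind hFm]
  refine lintegral_congr_ae ?_
  filter_upwards [ae_remaining_le_ageBound h hY hZ hQ] with ω hω
  refine lintegral_congr_ae ?_
  filter_upwards [h.delay_mem] with y hy
  have hy0 := h.pos.trans_le hy.1
  have := ((hZ j).2 ω).1
  have := hω j
  simp only [hF, hξ, afterRequest]
  split_ifs with hle
  · rfl
  · rw [h.value_of_neg (by linarith), max_eq_left (by linarith), max_eq_left (by linarith)]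

theorem lintegral_value_mono (h : IsSetting μ G M BL BU) (hY : IsDelayProcess P Y ℱ μ BL BU)
    (hZ : Z ∈ policies ℱ M) (hQ : 0 ≤ Q) :
    Monotone fun j => ∫⁻ ω, value μ G M BL (ageBound Y Z Q j ω) (remaining Y Z Q j ω) ∂P := by
  refine monotone_nat_of_le_succ fun j => ?_
  rw [lintegral_value_succ h hY hZ hQ]
  refine lintegral_mono_ae ?_
  filter_upwards [ae_remaining_le_ageBound h hY hZ hQ] with ω hω
  have := ((hZ j).2 ω).1
  have := ((hZ j).2 ω).2
  exact h.value_le_requestValue (hω j) (by linarith) (by linarith)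

/-- The request at the delivery of update `j` is optimal for the query at `Q`. -/
def IsOptimalAt (μ : Measure ℝ) (G : ℝ → ℝ≥0∞) (M BL : ℝ) (Y Z : ℕ → Ω → ℝ) (Q : ℝ) (j : ℕ)
    (ω : Ω) : Prop :=
  requestValue μ G (value μ G M BL) (ageBound Y Z Q j ω) (remaining Y Z Q j ω - Z j ω) =
    value μ G M BL (ageBound Y Z Q j ω) (remaining Y Z Q j ω)

theorem isOptimalAt_of_nonpos (h : IsSetting μ G M BL BU) (hZ : Z ∈ policies ℱ M) {j : ℕ} {ω : Ω}
    (hle : remaining Y Z Q j ω ≤ ageBound Y Z Q j ω) (h0 : remaining Y Z Q j ω ≤ 0) :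
    IsOptimalAt μ G M BL Y Z Q j ω := by
  have := ((hZ j).2 ω).1
  rw [IsOptimalAt, h.value_of_nonpos h0 hle, h.requestValue_of_nonpos _ (by linarith),
    max_eq_left (by linarith)]

theorem lintegral_value_eq (h : IsSetting μ G M BL BU) (hY : IsDelayProcess P Y ℱ μ BL BU)
    (hZ : Z ∈ policies ℱ M) (hQ : 0 ≤ Q)
    (hopt : ∀ᵐ ω ∂P, ∀ j, 0 < remaining Y Z Q j ω → IsOptimalAt μ G M BL Y Z Q j ω) (j : ℕ) :
    ∫⁻ ω, value μ G M BL (ageBound Y Z Q j ω) (remaining Y Z Q j ω) ∂P =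
      ∫⁻ ω, value μ G M BL (ageBound Y Z Q 0 ω) (remaining Y Z Q 0 ω) ∂P := by
  induction j with
  | zero => rfl
  | succ j ih =>
    rw [← ih, lintegral_value_succ h hY hZ hQ]
    refine lintegral_congr_ae ?_
    filter_upwards [ae_remaining_le_ageBound h hY hZ hQ, hopt] with ω hω hopt
    rcases le_or_gt (remaining Y Z Q j ω) 0 with h0 | h0
    · exact isOptimalAt_of_nonpos h hZ (hω j) h0
    · exact hopt j h0

/-- The penalty function, extended to negative ages. -/
def penalty (g : ℝ → ℝ) (x : ℝ) : ℝ≥0∞ := ENNReal.ofReal (g (max x 0))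

variable {g : ℝ → ℝ}

omit [IsProbabilityMeasure P] in
theorem ae_penalty_eq_value (h : IsSetting μ (penalty g) M BL BU)
    (hY : IsDelayProcess P Y ℱ μ BL BU) (hZ : Z ∈ policies ℱ M) (hQ : 0 ≤ Q) {n : ℕ}
    (hn : Q < n * BL) :
    (fun ω => ENNReal.ofReal (g (age (fun j => Y j ω) (fun j => Z j ω) Q))) =ᵐ[P]
      fun ω => value μ (penalty g) M BL (ageBound Y Z Q n ω) (remaining Y Z Q n ω) := by
  filter_upwards [hY.ae_bounds, ae_remaining_le_ageBound h hY hZ hQ] with ω hω hle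
  have hy : ∀ i, 0 ≤ Y i ω := fun i => h.pos.le.trans (hω i).1
  have hw : ∀ i, 0 ≤ Z i ω := fun i => ((hZ i).2 ω).1
  have hD : Q < delivery (fun i => Y i ω) (fun i => Z i ω) n :=
    hn.trans_le (mul_le_delivery (fun i => (hω i).1) hw n)
  have hneg : remaining Y Z Q n ω < 0 := sub_neg.2 hD
  have hpos : 0 ≤ ageBound Y Z Q n ω := sub_nonneg.2 (freshest_le hy hw hQ n)
  rw [h.value_of_neg hneg, max_eq_left (hle n), penalty, max_eq_left hpos, age,
    lastGeneration_eq_freshest hy hw hQ hD]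
  rfl

theorem exists_lt_mul (h : IsSetting μ G M BL BU) (Q : ℝ) : ∃ n : ℕ, 1 ≤ n ∧ Q < n * BL := by
  obtain ⟨n, hn⟩ := exists_nat_gt (Q / BL)
  have := (div_lt_iff₀ h.pos).1 hn
  refine ⟨n + 1, by omega, ?_⟩
  push_cast
  linarith [h.pos]

omit [IsProbabilityMeasure P] in
theorem expectedPenalty_eq_lintegral_value (h : IsSetting μ (penalty g) M BL BU)
    (hY : IsDelayProcess P Y ℱ μ BL BU) (hZ : Z ∈ policies ℱ M) (hQ : 0 ≤ Q) {n : ℕ}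
    (hn : Q < n * BL) : expectedPenalty P g Y Z Q =
      ∫⁻ ω, value μ (penalty g) M BL (ageBound Y Z Q n ω) (remaining Y Z Q n ω) ∂P :=
  lintegral_congr_ae (ae_penalty_eq_value h hY hZ hQ hn)

omit [IsProbabilityMeasure P] in
-- The age is defined by a supremum and `g` is controlled only on nonnegative ages, so measurability
-- is read off from the value at a late stage.
theorem aemeasurable_penalty_age (h : IsSetting μ (penalty g) M BL BU)
    (hY : IsDelayProcess P Y ℱ μ BL BU) (hZ : Z ∈ policies ℱ M) (hQ : 0 ≤ Q) :
    AEMeasurable (fun ω => ENNReal.ofReal (g (age (fun j => Y j ω) (fun j => Z j ω) Q))) P := by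
  obtain ⟨n, -, hn⟩ := exists_lt_mul h Q
  refine ⟨_, ?_, ae_penalty_eq_value h hY hZ hQ hn⟩
  have hYm := hY.info.measurable_delay
  have hZm := fun i => (hZ i).1
  exact h.lowerSemicontinuous_value.measurable.comp
    ((measurable_const.sub ((measurable_freshest hYm hZm Q n).mono (ℱ.le n) le_rfl)).prodMk
      (measurable_const.sub ((measurable_delivery hYm hZm n).mono (ℱ.le n) le_rfl)))

theorem lintegral_value_le_expectedPenalty (h : IsSetting μ (penalty g) M BL BU)
    (hY : IsDelayProcess P Y ℱ μ BL BU) (hZ : Z ∈ policies ℱ M) (hQ : 0 ≤ Q) :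
    ∫⁻ ω, value μ (penalty g) M BL (Y 0 ω + Q) Q ∂P ≤ expectedPenalty P g Y Z Q := by
  obtain ⟨n, -, hn⟩ := exists_lt_mul h Q
  rw [expectedPenalty_eq_lintegral_value h hY hZ hQ hn]
  simpa only [ageBound_zero, remaining_zero] using
    lintegral_value_mono h hY hZ hQ (Nat.zero_le n)

theorem expectedPenalty_eq_of_isOptimalAt (h : IsSetting μ (penalty g) M BL BU)
    (hY : IsDelayProcess P Y ℱ μ BL BU) (hZ : Z ∈ policies ℱ M) (hQ : 0 ≤ Q)
    (hopt : ∀ᵐ ω ∂P, ∀ j, 0 < remaining Y Z Q j ω →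
      IsOptimalAt μ (penalty g) M BL Y Z Q j ω) :
    expectedPenalty P g Y Z Q = ∫⁻ ω, value μ (penalty g) M BL (Y 0 ω + Q) Q ∂P := by
  obtain ⟨n, -, hn⟩ := exists_lt_mul h Q
  rw [expectedPenalty_eq_lintegral_value h hY hZ hQ hn, lintegral_value_eq h hY hZ hQ hopt]
  simp only [ageBound_zero, remaining_zero]

/-- A policy that attains the lower bound uses an optimal first request. -/
theorem lintegral_requestValue_le_expectedPenalty (h : IsSetting μ (penalty g) M BL BU)
    (hY : IsDelayProcess P Y ℱ μ BL BU) (hZ : Z ∈ policies ℱ M) (hQ : 0 ≤ Q) :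
    ∫⁻ ω, requestValue μ (penalty g) (value μ (penalty g) M BL) (Y 0 ω + Q) (Q - Z 0 ω) ∂P ≤
      expectedPenalty P g Y Z Q := by
  obtain ⟨n, hn1, hn⟩ := exists_lt_mul h Q
  rw [expectedPenalty_eq_lintegral_value h hY hZ hQ hn]
  refine le_trans (le_of_eq ?_) (lintegral_value_mono h hY hZ hQ hn1)
  simp only [lintegral_value_succ h hY hZ hQ 0, ageBound_zero, remaining_zero]

end Cost

/-! ### Feedback policies -/

variable {Ω : Type*} [mΩ : MeasurableSpace Ω]

section Feedback

variable {ℱ : Filtration ℕ mΩ} {Y : ℕ → Ω → ℝ} {f : ℝ → ℝ → ℝ}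

omit mΩ in
theorem delivery_feedbackPolicy (f : ℝ → ℝ → ℝ) (Y : ℕ → Ω → ℝ) (ω : Ω) (j : ℕ) :
    delivery (fun i => Y i ω) (fun i => feedbackPolicy f Y i ω) j =
      feedbackDelivery f (fun i => Y i ω) j := by
  induction j with
  | zero => rfl
  | succ j ih =>
    rw [delivery, ih]
    rfl

theorem measurable_feedbackDelivery (hY : ∀ j, Measurable[ℱ j] (Y j))
    (hf : Measurable (Function.uncurry f)) (j : ℕ) :
    Measurable[ℱ j] fun ω => feedbackDelivery f (fun i => Y i ω) j := by
  induction j with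
  | zero => exact measurable_const
  | succ j ih =>
    have h1 : Measurable[ℱ j] fun ω =>
        feedbackDelivery f (fun i => Y i ω) j + f (Y j ω) (feedbackDelivery f (fun i => Y i ω) j) :=
      ih.add (hf.comp ((hY j).prodMk ih))
    exact (h1.mono (ℱ.mono j.le_succ) le_rfl).add (hY (j + 1))

theorem feedbackPolicy_mem {M : ℝ} (hY : ∀ j, Measurable[ℱ j] (Y j))
    (hf : Measurable (Function.uncurry f)) (hfM : ∀ y d, f y d ∈ Set.Icc 0 M) :
    feedbackPolicy f Y ∈ policies ℱ M := fun j =>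
  ⟨hf.comp ((hY j).prodMk (measurable_feedbackDelivery hY hf j)), fun _ => hfM _ _⟩

theorem singleQueryPolicy_mem {M : ℝ} {z : ℝ → ℝ → ℝ} (hY : ∀ j, Measurable[ℱ j] (Y j))
    (hz : Measurable (Function.uncurry z)) (hzM : ∀ y a, z y a ∈ Set.Icc 0 M) (Q : ℝ) :
    singleQueryPolicy z Q Y ∈ policies ℱ M :=
  feedbackPolicy_mem hY (hz.comp (f := fun p : ℝ × ℝ => (p.1, Q - p.2)) (by fun_prop))
    fun _ _ => hzM _ _

theorem repeatedPolicy_mem {M : ℝ} {z : ℝ → ℝ → ℝ} (hY : ∀ j, Measurable[ℱ j] (Y j))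
    (hz : Measurable (Function.uncurry z)) (hzM : ∀ y a, z y a ∈ Set.Icc 0 M) (T : ℝ) :
    repeatedPolicy z T Y ∈ policies ℱ M := by
  refine feedbackPolicy_mem hY (hz.comp
    (f := fun p : ℝ × ℝ => (p.1, T * ((⌊p.2 / T⌋ : ℝ) + 1) - p.2)) ?_) fun _ _ => hzM _ _
  have : Measurable fun p : ℝ × ℝ => (⌊p.2 / T⌋ : ℝ) :=
    measurable_from_top.comp (Int.measurable_floor.comp (by fun_prop))
  fun_prop

omit mΩ in
theorem singleQueryPolicy_apply (z : ℝ → ℝ → ℝ) (Q : ℝ) (Y : ℕ → Ω → ℝ) (j : ℕ) (ω : Ω) :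
    singleQueryPolicy z Q Y j ω =
      z (Y j ω) (remaining Y (singleQueryPolicy z Q Y) Q j ω) := by
  unfold remaining singleQueryPolicy
  rw [delivery_feedbackPolicy]
  rfl

omit mΩ in
theorem repeatedPolicy_apply (z : ℝ → ℝ → ℝ) (T : ℝ) (Y : ℕ → Ω → ℝ) (j : ℕ) (ω : Ω) :
    let D := delivery (fun i => Y i ω) (fun i => repeatedPolicy z T Y i ω) j
    repeatedPolicy z T Y j ω = z (Y j ω) (T * ((⌊D / T⌋ : ℝ) + 1) - D) := by
  intro D
  simp only [D]
  unfold repeatedPolicy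
  rw [delivery_feedbackPolicy]
  rfl

end Feedback

/-! ### Optimal decision functions -/

section Optimal

variable {P : Measure Ω} [IsProbabilityMeasure P] {Y : ℕ → Ω → ℝ} {ℱ : Filtration ℕ mΩ}
  {μ : Measure ℝ} {M BL BU : ℝ} {g : ℝ → ℝ} {z : ℝ → ℝ → ℝ}

omit [IsProbabilityMeasure P] in
-- This lets all cost estimates be applied from an arbitrary deterministic state.
theorem IsDelayProcess.withInitialAge (hY : IsDelayProcess P Y ℱ μ BL BU) {y : ℝ}
    (hy : y ∈ Set.Icc BL BU) : IsDelayProcess P (withInitialAge Y y) ℱ μ BL BU := by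
  have hsucc : ∀ j, PullOrWait.withInitialAge Y y (j + 1) = Y (j + 1) := fun j =>
    Function.update_of_ne j.succ_ne_zero _ _
  have hzero : PullOrWait.withInitialAge Y y 0 = fun _ => y := Function.update_self _ _ _
  refine ⟨⟨fun j => ?_, fun j => ?_⟩, fun j => ?_, fun j => ?_⟩
  · cases j with
    | zero => rw [hzero]; exact measurable_const
    | succ j => rw [hsucc]; exact hY.info.measurable_delay _
  · rw [hsucc]; exact hY.info.indep_next j
  · rw [hsucc]; exact hY.law j
  · cases j with
    | zero => rw [hzero]; exact ae_of_all _ fun _ => hy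
    | succ j => rw [hsucc]; exact hY.mem _

omit mΩ in
theorem withInitialAge_zero (Y : ℕ → Ω → ℝ) (y : ℝ) (ω : Ω) : withInitialAge Y y 0 ω = y := by
  simp [withInitialAge]

/-- `z` attains the minimum in the Bellman equation. -/
def AttainsBellman (μ : Measure ℝ) (G : ℝ → ℝ≥0∞) (M BL BU : ℝ) (z : ℝ → ℝ → ℝ) : Prop :=
  ∀ a, 0 < a → ∀ y ∈ Set.Icc BL BU,
    requestValue μ G (value μ G M BL) (y + a) (a - z y a) = value μ G M BL (y + a) a

omit mΩ in
theorem AttainsBellman.isOptimalAt {G : ℝ → ℝ≥0∞} (hz : AttainsBellman μ G M BL BU z)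
    {Z : ℕ → Ω → ℝ} {Q : ℝ} {j : ℕ} {ω : Ω} (hYj : Y j ω ∈ Set.Icc BL BU)
    (h0 : 0 < remaining Y Z Q j ω) (hZ : Z j ω = z (Y j ω) (remaining Y Z Q j ω)) :
    IsOptimalAt μ G M BL Y Z Q j ω := by
  rw [IsOptimalAt, ageBound_of_remaining_nonneg h0.le, hZ]
  exact hz _ h0 _ hYj

theorem AttainsBellman.expectedPenalty_singleQueryPolicy
    (hz : AttainsBellman μ (penalty g) M BL BU z)
    (h : IsSetting μ (penalty g) M BL BU) (hY : IsDelayProcess P Y ℱ μ BL BU)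
    (hzm : Measurable (Function.uncurry z)) (hzM : ∀ y a, z y a ∈ Set.Icc 0 M) {Q : ℝ}
    (hQ : 0 ≤ Q) : expectedPenalty P g Y (singleQueryPolicy z Q Y) Q =
      ∫⁻ ω, value μ (penalty g) M BL (Y 0 ω + Q) Q ∂P := by
  refine expectedPenalty_eq_of_isOptimalAt h hY
    (singleQueryPolicy_mem hY.info.measurable_delay hzm hzM Q) hQ ?_
  filter_upwards [hY.ae_bounds] with ω hω j h0
  exact hz.isOptimalAt (hω j) h0 (singleQueryPolicy_apply z Q Y j ω)

theorem exists_isOptimalDecision (h : IsSetting μ (penalty g) M BL BU)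
    (hY : IsDelayProcess P Y ℱ μ BL BU) :
    ∃ z, IsOptimalDecision P ℱ M BL BU g Y z ∧ AttainsBellman μ (penalty g) M BL BU z := by
  obtain ⟨z, hzm, hzM, hza, hz⟩ := h.exists_decision
  have hz' : AttainsBellman μ (penalty g) M BL BU z := fun a ha y hy =>
    hz y a (h.pos.le.trans hy.1) ha.le
  refine ⟨z, ⟨hzm, hzM, hza, fun a ha y hy Z hZ => ?_⟩, hz'⟩
  rw [hz'.expectedPenalty_singleQueryPolicy h (hY.withInitialAge hy) hzm hzM ha.le]
  exact lintegral_value_le_expectedPenalty h (hY.withInitialAge hy) hZ ha.le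

/-- From a deterministic start the expectations are plain values. The cost of the first request
followed by optimal play is squeezed between the optimum and the penalty of `z`, which is itself
optimal. -/
theorem IsOptimalDecision.attainsBellman (hz : IsOptimalDecision P ℱ M BL BU g Y z)
    (h : IsSetting μ (penalty g) M BL BU) (hY : IsDelayProcess P Y ℱ μ BL BU) :
    AttainsBellman μ (penalty g) M BL BU z := by
  intro a ha y hy
  have hYy := hY.withInitialAge hy
  have hmem := singleQueryPolicy_mem hYy.info.measurable_delay hz.measurable hz.mem_Icc a
  obtain ⟨z', hz', hB'⟩ := exists_isOptimalDecision h hY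
  have hle := hz.optimal a ha y hy _
    (singleQueryPolicy_mem hYy.info.measurable_delay hz'.measurable hz'.mem_Icc a)
  rw [hB'.expectedPenalty_singleQueryPolicy h hYy hz'.measurable hz'.mem_Icc ha.le] at hle
  have hreq := lintegral_requestValue_le_expectedPenalty h hYy hmem ha.le
  simp only [singleQueryPolicy_apply, remaining_zero, withInitialAge_zero, lintegral_const,
    measure_univ, mul_one] at hle hreq
  have hza := hz.mem_Icc y a
  have := h.pos.trans_le hy.1
  exact le_antisymm (hreq.trans hle) (h.value_le_requestValue (by linarith)
    (by linarith [hza.2]) (by linarith [hza.1]))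

theorem singleQueryOpt_eq (h : IsSetting μ (penalty g) M BL BU)
    (hY : IsDelayProcess P Y ℱ μ BL BU) {Q : ℝ} (hQ : 0 ≤ Q) :
    singleQueryOpt P ℱ M g Y Q = ∫⁻ ω, value μ (penalty g) M BL (Y 0 ω + Q) Q ∂P := by
  obtain ⟨z, hz, hB⟩ := exists_isOptimalDecision h hY
  refine le_antisymm ?_ (le_iInf₂ fun Z hZ => lintegral_value_le_expectedPenalty h hY hZ hQ)
  rw [← hB.expectedPenalty_singleQueryPolicy h hY hz.measurable hz.mem_Icc hQ]
  exact iInf₂_le _ (singleQueryPolicy_mem hY.info.measurable_delay hz.measurable hz.mem_Icc Q)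

theorem lintegral_value_eq_steadyValue (h : IsSetting μ (penalty g) M BL BU)
    (hY : IsDelayProcess P Y ℱ μ BL BU) {Q : ℝ} (hQ : 3 * BU ≤ Q) :
    ∫⁻ ω, value μ (penalty g) M BL (Y 0 ω + Q) Q ∂P = steadyValue μ (penalty g) M BL BU := by
  have : ∀ᵐ ω ∂P, value μ (penalty g) M BL (Y 0 ω + Q) Q = steadyValue μ (penalty g) M BL BU := by
    filter_upwards [hY.ae_bounds] with ω hω
    have := h.pos.trans_le (hω 0).1
    exact h.value_eq_steadyValue hQ (by linarith)
  rw [lintegral_congr_ae this]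
  simp

/-! ### Periodic queries -/

theorem AttainsBellman.expectedPenalty_repeatedPolicy (hz : AttainsBellman μ (penalty g) M BL BU z)
    (h : IsSetting μ (penalty g) M BL BU) (hY : IsDelayProcess P Y ℱ μ BL BU)
    (hzm : Measurable (Function.uncurry z)) (hzM : ∀ y a, z y a ∈ Set.Icc 0 M)
    (hza : ∀ y a, 0 ≤ a → z y a ≤ a) {T : ℝ} (hT : 4 * BU < T) {k : ℕ} (hk : 1 ≤ k) :
    expectedPenalty P g Y (repeatedPolicy z T Y) (k * T) =
      steadyValue μ (penalty g) M BL BU := by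
  have hBU := h.BU_pos
  have hT0 : 0 < T := by linarith
  have hk1 : (1 : ℝ) ≤ k := by exact_mod_cast hk
  have hkT : T ≤ k * T := le_mul_of_one_le_left hT0.le hk1
  have hmem := repeatedPolicy_mem hY.info.measurable_delay hzm hzM T
  rw [← lintegral_value_eq_steadyValue h hY (Q := k * T) (by linarith)]
  refine expectedPenalty_eq_of_isOptimalAt h hY hmem (by linarith) ?_
  filter_upwards [hY.ae_bounds, ae_remaining_le_ageBound h hY hmem (Q := k * T) (by linarith)]
    with ω hω hle j h0
  have hZ := repeatedPolicy_apply z T Y j ω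
  set D := delivery (fun i => Y i ω) (fun i => repeatedPolicy z T Y i ω) j with hD
  have hrem : remaining Y (repeatedPolicy z T Y) (k * T) j ω = k * T - D := rfl
  simp only at hZ
  have hDlt : D < k * T := by linarith
  rcases lt_or_ge D ((k - 1) * T) with hlt | hge
  · have hfloor : ⌊D / T⌋ < (k : ℤ) - 1 := by
      rw [Int.floor_lt, div_lt_iff₀ hT0]
      push_cast
      exact hlt
    have hfloor' : (⌊D / T⌋ : ℝ) + 1 ≤ k - 1 := by exact_mod_cast hfloor
    have hDnext : D < T * ((⌊D / T⌋ : ℝ) + 1) := by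
      have := (div_lt_iff₀ hT0).1 (Int.lt_floor_add_one (D / T))
      linarith
    have hZle := hza (Y j ω) _ (sub_nonneg.2 hDnext.le)
    rw [← hZ] at hZle
    have hbound : T * ((⌊D / T⌋ : ℝ) + 1) ≤ T * (k - 1) := by gcongr
    have hs : T ≤ k * T - D - repeatedPolicy z T Y j ω := by linarith
    have hlej := hle j
    rw [hrem] at hlej
    rw [IsOptimalAt, hrem, h.requestValue_eq_steadyValue _ (by linarith),
      h.value_eq_steadyValue (by linarith) hlej]
  · have hfloor : ⌊D / T⌋ = (k : ℤ) - 1 := by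
      rw [Int.floor_eq_iff, le_div_iff₀ hT0, div_lt_iff₀ hT0]
      push_cast
      exact ⟨hge, by linarith⟩
    refine hz.isOptimalAt (hω j) h0 ?_
    rw [hZ, hrem, hfloor]
    congr 1
    push_cast
    ring

theorem queryAverage_eq (h : IsSetting μ (penalty g) M BL BU)
    (hY : IsDelayProcess P Y ℱ μ BL BU) {Z : ℕ → Ω → ℝ} (hZ : Z ∈ policies ℱ M) {Q : ℕ → ℝ}
    (hQ : ∀ k, 0 ≤ Q k) : queryAverage P g Y Z Q = limsup (fun n : ℕ =>
      (∑ k ∈ Finset.Icc 1 n, expectedPenalty P g Y Z (Q k)) / (n : ℝ≥0∞)) atTop := by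
  unfold queryAverage
  congr 1
  ext n
  rw [lintegral_finsetSum' _ fun k _ => aemeasurable_penalty_age h hY hZ (hQ k)]
  rfl

theorem sum_const_div_eventuallyEq (c : ℝ≥0∞) :
    (fun n : ℕ => (∑ _k ∈ Finset.Icc 1 n, c) / (n : ℝ≥0∞)) =ᶠ[atTop] fun _ => c := by
  -- At `n = 0` the average is `0 / 0 = 0`, so equality holds only eventually.
  filter_upwards [eventually_ge_atTop 1] with n hn
  have hn0 : (n : ℝ≥0∞) ≠ 0 := by
    rw [Nat.cast_ne_zero]
    omega
  rw [Finset.sum_const, Nat.card_Icc, Nat.add_sub_cancel, nsmul_eq_mul,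
    mul_comm, ENNReal.mul_div_cancel_right hn0 (ENNReal.natCast_ne_top n)]

theorem steadyValue_le_queryAverage (h : IsSetting μ (penalty g) M BL BU)
    (hY : IsDelayProcess P Y ℱ μ BL BU) {Z : ℕ → Ω → ℝ} (hZ : Z ∈ policies ℱ M) {T : ℝ}
    (hT : 4 * BU < T) :
    steadyValue μ (penalty g) M BL BU ≤ queryAverage P g Y Z fun k => k * T := by
  have hBU := h.BU_pos
  have hT0 : 0 < T := by linarith
  rw [queryAverage_eq h hY hZ fun k => by positivity]
  refine le_trans (le_of_eq ?_) (limsup_le_limsup (u := fun n : ℕ =>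
    (∑ _k ∈ Finset.Icc 1 n, steadyValue μ (penalty g) M BL BU) / (n : ℝ≥0∞))
    (Eventually.of_forall fun n => ?_))
  · rw [limsup_congr (sum_const_div_eventuallyEq _), limsup_const]
  · refine ENNReal.div_le_div_right (Finset.sum_le_sum fun k hk => ?_) _
    have hk1 : (1 : ℝ) ≤ k := by exact_mod_cast (Finset.mem_Icc.1 hk).1
    have hkT : T ≤ k * T := le_mul_of_one_le_left hT0.le hk1
    rw [← lintegral_value_eq_steadyValue h hY (Q := k * T) (by linarith)]
    exact lintegral_value_le_expectedPenalty h hY hZ (by linarith)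

theorem AttainsBellman.queryAverage_repeatedPolicy (hz : AttainsBellman μ (penalty g) M BL BU z)
    (h : IsSetting μ (penalty g) M BL BU) (hY : IsDelayProcess P Y ℱ μ BL BU)
    (hzm : Measurable (Function.uncurry z)) (hzM : ∀ y a, z y a ∈ Set.Icc 0 M)
    (hza : ∀ y a, 0 ≤ a → z y a ≤ a) {T : ℝ} (hT : 4 * BU < T) :
    (queryAverage P g Y (repeatedPolicy z T Y) fun k => k * T) =
      steadyValue μ (penalty g) M BL BU := by
  have hBU := h.BU_pos
  have hT0 : 0 < T := by linarith
  rw [queryAverage_eq h hY (repeatedPolicy_mem hY.info.measurable_delay hzm hzM T)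
    fun k => by positivity]
  rw [← limsup_const (f := (atTop : Filter ℕ)) (steadyValue μ (penalty g) M BL BU)]
  refine limsup_congr (EventuallyEq.trans (Eventually.of_forall fun n => ?_)
    (sum_const_div_eventuallyEq _))
  dsimp only
  congr 1
  exact Finset.sum_congr rfl fun k hk =>
    hz.expectedPenalty_repeatedPolicy h hY hzm hzM hza hT (Finset.mem_Icc.1 hk).1

theorem powOpt_eq (h : IsSetting μ (penalty g) M BL BU) (hY : IsDelayProcess P Y ℱ μ BL BU)
    {T : ℝ} (hT : 4 * BU < T) :
    powOpt P ℱ M g Y (fun k => k * T) = steadyValue μ (penalty g) M BL BU := by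
  obtain ⟨z, hz, hB⟩ := exists_isOptimalDecision h hY
  refine le_antisymm ?_ (le_iInf₂ fun Z hZ => steadyValue_le_queryAverage h hY hZ hT)
  rw [← hB.queryAverage_repeatedPolicy h hY hz.measurable hz.mem_Icc hz.le_remaining hT]
  exact iInf₂_le _ (repeatedPolicy_mem hY.info.measurable_delay hz.measurable hz.mem_Icc T)

theorem steadyValue_ne_top (h : IsSetting μ (penalty g) M BL BU) :
    steadyValue μ (penalty g) M BL BU ≠ ⊤ := by
  rw [← h.value_eq_steadyValue (x := 3 * BU) le_rfl le_rfl]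
  exact ((h.value_le _ _).trans_lt ENNReal.ofReal_lt_top).ne

end Optimal

/-! ### From `g` to the abstract setting, and the conclusion -/

theorem continuous_penalty {g : ℝ → ℝ} (hg : ContinuousOn g (Set.Ici 0)) :
    Continuous (penalty g) :=
  ENNReal.continuous_ofReal.comp
    (hg.comp_continuous (by fun_prop) fun x => Set.mem_Ici.2 (le_max_right x 0))

theorem monotone_penalty {g : ℝ → ℝ} (hg : MonotoneOn g (Set.Ici 0)) : Monotone (penalty g) :=
  fun _ _ hxy => ENNReal.ofReal_le_ofReal
    (hg (Set.mem_Ici.2 (le_max_right _ _)) (Set.mem_Ici.2 (le_max_right _ _))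
      (max_le_max_right 0 hxy))

end PullOrWait

end

theorem proposition5 {Ω : Type*} [mΩ : MeasurableSpace Ω] (P : Measure Ω) [IsProbabilityMeasure P]
    (Y : ℕ → Ω → ℝ) (ℱ : Filtration ℕ mΩ) (BL BU M T : ℝ) (g : ℝ → ℝ)
    (hBL : 0 < BL)
    (hiid : iIndepFun Y P) (hid : ∀ j, IdentDistrib (Y j) (Y 0) P P)
    (hbound : ∀ j, ∀ᵐ ω ∂P, Y j ω ∈ Set.Icc BL BU)
    (hinfo : PullOrWait.IsInformation P Y ℱ)
    (hM : BU ≤ M)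
    (hT : 4 * BU < T)
    (hgcont : ContinuousOn g (Set.Ici 0)) (hgmono : MonotoneOn g (Set.Ici 0))
    (hgnonneg : ∀ x, 0 ≤ x → 0 ≤ g x) :
    -- the optimal PoW value is the optimal single-query value, common to all `Q > 3 B_U`
    (∀ Q, 3 * BU < Q →
      PullOrWait.powOpt P ℱ M g Y (fun k => (k : ℝ) * T)
        = PullOrWait.singleQueryOpt P ℱ M g Y Q) ∧
    PullOrWait.powOpt P ℱ M g Y (fun k => (k : ℝ) * T) ≠ ⊤ ∧
    -- optimal stationary deterministic single-query policies exist
    (∃ z, PullOrWait.IsOptimalDecision P ℱ M BL BU g Y z) ∧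
    -- each of them attains the single-query minimum and, applied anew in each query interval,
    -- attains the PoW minimum, with the optimal value at every query
    ∀ z, PullOrWait.IsOptimalDecision P ℱ M BL BU g Y z →
      (∀ Q, 0 < Q →
        PullOrWait.singleQueryPolicy z Q Y ∈ PullOrWait.policies ℱ M ∧
        PullOrWait.expectedPenalty P g Y (PullOrWait.singleQueryPolicy z Q Y) Q
          = PullOrWait.singleQueryOpt P ℱ M g Y Q) ∧
      PullOrWait.repeatedPolicy z T Y ∈ PullOrWait.policies ℱ M ∧
      PullOrWait.queryAverage P g Y (PullOrWait.repeatedPolicy z T Y) (fun k => (k : ℝ) * T)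
        = PullOrWait.powOpt P ℱ M g Y (fun k => (k : ℝ) * T) ∧
      ∀ k : ℕ, 1 ≤ k →
        PullOrWait.expectedPenalty P g Y (PullOrWait.repeatedPolicy z T Y) ((k : ℝ) * T)
          = PullOrWait.powOpt P ℱ M g Y (fun k => (k : ℝ) * T) := by
  have hset : PullOrWait.IsSetting (P.map (Y 0)) (PullOrWait.penalty g) M BL BU :=
    ⟨Measure.isProbabilityMeasure_map (hid 0).aemeasurable_fst, hBL,
      (ae_map_iff (hid 0).aemeasurable_fst measurableSet_Icc).2 (hbound 0), hM,
      PullOrWait.continuous_penalty hgcont, PullOrWait.monotone_penalty hgmono⟩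
  have hY : PullOrWait.IsDelayProcess P Y ℱ (P.map (Y 0)) BL BU :=
    ⟨hinfo, fun j => (hid (j + 1)).map_eq, hbound⟩
  have hBU := hset.BU_pos
  rw [PullOrWait.powOpt_eq hset hY hT]
  refine ⟨fun Q hQ => ?_, PullOrWait.steadyValue_ne_top hset, ?_, fun z hz => ?_⟩
  · rw [PullOrWait.singleQueryOpt_eq hset hY (by linarith),
      PullOrWait.lintegral_value_eq_steadyValue hset hY hQ.le]
  · obtain ⟨z, hz, -⟩ := PullOrWait.exists_isOptimalDecision hset hY
    exact ⟨z, hz⟩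
  · have hB := hz.attainsBellman hset hY
    refine ⟨fun Q hQ => ⟨PullOrWait.singleQueryPolicy_mem hinfo.measurable_delay hz.measurable
      hz.mem_Icc Q, ?_⟩, PullOrWait.repeatedPolicy_mem hinfo.measurable_delay hz.measurable
      hz.mem_Icc T, hB.queryAverage_repeatedPolicy hset hY hz.measurable hz.mem_Icc
      hz.le_remaining hT, fun k hk => hB.expectedPenalty_repeatedPolicy hset hY hz.measurable
      hz.mem_Icc hz.le_remaining hT hk⟩
    rw [hB.expectedPenalty_singleQueryPolicy hset hY hz.measurable hz.mem_Icc hQ.le,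
      PullOrWait.singleQueryOpt_eq hset hY hQ.le]
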